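/- Let $n$ and $r$ be integers with $1 \le r \le n-1$, and let $U^{r,n}$ be the uniform matroid of rank $r$ on $[n]$, whose bases are all $r$-element subsets of $[n]$. Let $P(U^{r,n}) = \mathrm{conv}\{\, e_B \mid B \subseteq [n],\ |B| = r \,\} \subset \mathbb{R}^n$ be its matroid base polytope, where $e_B$ is the $0/1$ incidence vector of $B$. For a vertex $v$ of $P(U^{r,n})$, let $C_v$ be the tangent cone at $v$, translated to the origin, that is, the convex cone generated by $\{\, p - v \mid p \in P(U^{r,n}) \,\}$. A triangulation of $C_v$ is a finite collection of simplicial cones, each generated by linearly independent vectors spanning extreme rays of $C_v$ (no new rays are introduced), which is closed under taking faces, in which any two cones intersect in a common face of both, and whose union is $C_v$. Then, for every vertex $v$ of $P(U^{r,n})$, every triangulation of $C_v$ has exactly $\binom{n-2}{r-1}$ maximal simplicial cones. Consequently, when the rank varies with $n$, this number can grow exponentially: there are constants $A > 0$ and $c > 1$ such that for every even $n \ge 2$ and every vertex $v$ of $P(U^{n/2,n})$, every triangulation of $C_v$ has at least $A\,c^{n}$ maximal simplicial cones. -/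

import Mathlib

/-- The uniform matroid `U^{r,n}` on the ground set `Fin n`: a set is independent if and only if
it has at most `r` elements. -/
noncomputable def uniformMatroid (r n : ℕ) : Matroid (Fin n) :=
  (IndepMatroid.ofFinite (E := Set.univ) Set.finite_univ (fun I => I.ncard ≤ r)
    (by simp)
    (fun I J hJ hIJ => (Set.ncard_le_ncard hIJ J.toFinite).trans hJ)
    (fun I J _ hJ hlt => by
      obtain ⟨e, heJ, heI⟩ := Set.exists_mem_notMem_of_ncard_lt_ncard hlt I.toFinite
      exact ⟨e, heJ, heI, (Set.ncard_insert_le e I).trans (by omega)⟩)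
    (fun I _ => Set.subset_univ I)).matroid

/-- The matroid base polytope of `M`: the convex hull in `ℝ^α` of the incidence vectors of the
bases of `M`. -/
noncomputable def basePolytope {α : Type*} (M : Matroid α) : Set (α → ℝ) :=
  convexHull ℝ {x | ∃ B : Set α, M.IsBase B ∧ x = B.indicator 1}

/-- The tangent cone of the polytope `P` at the point `v`, translated so that its apex is the
origin: the convex cone generated by the vectors `p - v` with `p ∈ P`. -/
noncomputable def tangentConeOf {E : Type*} [AddCommGroup E] [Module ℝ E] (P : Set E) (v : E) :
    PointedCone ℝ E :=
  PointedCone.hull ℝ ((fun p => p - v) '' P)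

/-- `T` is a triangulation of the convex cone `C` (without new rays): a finite polyhedral fan of
simplicial cones, each of them generated by linearly independent vectors that span
one-dimensional faces (extreme rays) of `C`, whose union is `C`. -/
structure IsConeTriangulation {E : Type*} [AddCommGroup E] [Module ℝ E]
    (C : PointedCone ℝ E) (T : Set (PointedCone ℝ E)) : Prop where
  finite : T.Finite
  simplicial : ∀ σ ∈ T, ∃ s : Set E, s.Finite ∧ LinearIndepOn ℝ id s ∧
    PointedCone.hull ℝ s = σ ∧ ∀ x ∈ s, (PointedCone.hull ℝ {x}).IsFaceOf C
  face_mem : ∀ σ ∈ T, ∀ F : PointedCone ℝ E, F.IsFaceOf σ → F ∈ T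
  inter_isFaceOf : ∀ σ ∈ T, ∀ τ ∈ T, (σ ⊓ τ).IsFaceOf σ ∧ (σ ⊓ τ).IsFaceOf τ
  union_eq : ⋃ σ ∈ T, (σ : Set E) = C

/-- The number of maximal cones (with respect to inclusion) of a collection of cones. -/
noncomputable def numMaximalCones {E : Type*} [AddCommGroup E] [Module ℝ E]
    (T : Set (PointedCone ℝ E)) : ℕ :=
  {σ | Maximal (fun τ => τ ∈ T) σ}.ncard

/-! At the vertex `e_B` the tangent cone is generated by the roots `e_j - e_i` with `i ∈ B`, `j ∉
B`, so simplicial cones without new rays correspond to forests in the complete bipartite graph on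
`B` and `Bᶜ`, and full-dimensional ones to spanning trees. The maximal cones are counted by a finite
set of test points chosen independently of the triangulation.

With `r = |B|`, a test point has coordinate `1` off `B` and `-(a i + 1/r)` on `B`, where the
naturals `a i` sum to `n - r - 1`; stars and bars gives `(n-2).choose (r-1)` of them. Deleting an
edge of a forest yields a cut `K`, and the coefficient of that edge is minus the coordinate sum over
`K`, which is `|K ∩ B|/r` plus an integer. It never vanishes (`IsCut.coeff_testPoint_ne_zero`), so
test points avoid all lower-dimensional cones and all boundaries. In a cone that contains the point
the coefficient lies in `(0, 1]`, hence equals `|K ∩ B|/r` whatever `a` is: a cone holds at most one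
test point (`eq_of_testPoint_mem_hull`). Rounding coefficients into `(0, 1]` shows that a spanning
tree cone holds at least one (`IsRootBasis.exists_testPoint_mem_hull`). As maximal cones are
full-dimensional, they are in bijection with test points. -/

/-- The vector `e_j - e_i` attached to the pair `(i, j)`. -/
def rootVector {α : Type*} [DecidableEq α] (e : α × α) : α → ℝ :=
  Pi.single e.2 1 - Pi.single e.1 1

theorem mem_hull_image_finset {E ι : Type*} [AddCommGroup E] [Module ℝ E] {v : ι → E}
    {S : Finset ι} {x : E} :
    x ∈ PointedCone.hull ℝ (v '' S) ↔
      ∃ c : ι → ℝ, (∀ e ∈ S, 0 ≤ c e) ∧ ∑ e ∈ S, c e • v e = x := by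
  classical
  constructor
  · intro h
    obtain ⟨c, rfl⟩ := (Submodule.mem_span_image_finset_iff_exists_fun _).1 h
    refine ⟨fun e => if he : e ∈ S then c ⟨e, he⟩ else 0, fun e he => ?_, ?_⟩
    · simpa [he] using (c ⟨e, he⟩).2
    · rw [← Finset.sum_coe_sort]
      refine Finset.sum_congr rfl fun e _ => ?_
      simp only [e.2, dite_true]
      rfl
  · rintro ⟨c, hc, rfl⟩
    exact Submodule.sum_mem _ fun e he =>
      PointedCone.smul_mem _ (hc e he) (PointedCone.subset_hull ⟨e, he, rfl⟩)

theorem sum_rootVector {α : Type*} [DecidableEq α] (K : Finset α) (e : α × α) :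
    ∑ i ∈ K, rootVector e i = (if e.2 ∈ K then 1 else 0) - (if e.1 ∈ K then 1 else 0) := by
  simp [rootVector, Pi.single_apply]

/-! ### Linear inequalities of the cone of roots. -/

section Roots

variable {α : Type*} [Fintype α] [DecidableEq α]

theorem sum_smul_rootVector_apply_of_mem {B : Finset α} {S : Finset (α × α)}
    (hS : S ⊆ B ×ˢ Bᶜ) (c : α × α → ℝ) {i : α} (hi : i ∈ B) :
    (∑ e ∈ S, c e • rootVector e) i = -∑ e ∈ S with e.1 = i, c e := by
  rw [Finset.sum_apply, Finset.sum_filter, ← Finset.sum_neg_distrib]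
  refine Finset.sum_congr rfl fun e he => ?_
  have h := Finset.mem_product.1 (hS he)
  have h2 : i ≠ e.2 := fun h' => Finset.mem_compl.1 h.2 (h' ▸ hi)
  by_cases h1 : e.1 = i
  · simp [rootVector, h1, h2]
  · simp [rootVector, h1, h2, Ne.symm h1]

theorem sum_smul_rootVector_apply_of_notMem {B : Finset α} {S : Finset (α × α)}
    (hS : S ⊆ B ×ˢ Bᶜ) (c : α × α → ℝ) {j : α} (hj : j ∉ B) :
    (∑ e ∈ S, c e • rootVector e) j = ∑ e ∈ S with e.2 = j, c e := by
  rw [Finset.sum_apply, Finset.sum_filter]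
  refine Finset.sum_congr rfl fun e he => ?_
  have h := Finset.mem_product.1 (hS he)
  have h2 : j ≠ e.1 := fun h' => hj (h' ▸ h.1)
  by_cases h1 : e.2 = j
  · simp [rootVector, h1, h2]
  · simp [rootVector, h1, h2, Ne.symm h1]

/-- The cone generated by all roots from `B` to its complement. -/
theorem mem_hull_rootVector_iff {B : Finset α} {x : α → ℝ} :
    x ∈ PointedCone.hull ℝ (rootVector '' ((B ×ˢ Bᶜ : Finset (α × α)) : Set (α × α))) ↔
      (∀ i ∈ B, x i ≤ 0) ∧ (∀ j ∉ B, 0 ≤ x j) ∧ ∑ i, x i = 0 := by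
  rw [mem_hull_image_finset]
  constructor
  · rintro ⟨c, hc, rfl⟩
    refine ⟨fun i hi => ?_, fun j hj => ?_, ?_⟩
    · rw [sum_smul_rootVector_apply_of_mem subset_rfl c hi, neg_nonpos]
      exact Finset.sum_nonneg fun e he => hc e (Finset.mem_filter.1 he).1
    · rw [sum_smul_rootVector_apply_of_notMem subset_rfl c hj]
      exact Finset.sum_nonneg fun e he => hc e (Finset.mem_filter.1 he).1
    · simp only [Finset.sum_apply, Pi.smul_apply]
      rw [Finset.sum_comm]
      refine Finset.sum_eq_zero fun e _ => ?_
      rw [← Finset.smul_sum, sum_rootVector]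
      simp
  · rintro ⟨h1, h2, h3⟩
    set s := ∑ j ∈ Bᶜ, x j with hs
    have hsB : ∑ i ∈ B, x i = -s := by
      rw [← Finset.sum_add_sum_compl B] at h3
      linarith
    have hs0 : 0 ≤ s := Finset.sum_nonneg fun j hj => h2 j (Finset.mem_compl.1 hj)
    -- Proportional transport plan with supplies `-x i`, demands `x j` and total mass `s`. For `s =
    -- 0` every quotient is `0`, which is right because then `x = 0`.
    refine ⟨fun e => -x e.1 * x e.2 / s, fun e he => ?_, ?_⟩
    · have h := Finset.mem_product.1 he
      exact div_nonneg (mul_nonneg (neg_nonneg.2 (h1 _ h.1)) (h2 _ (Finset.mem_compl.1 h.2))) hs0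
    rcases hs0.eq_or_lt with h0 | h0
    · have hx : x = 0 := by
        funext i
        by_cases hi : i ∈ B
        · have : ∑ i ∈ B, -x i = 0 := by rw [Finset.sum_neg_distrib, hsB, ← h0]; simp
          rw [Finset.sum_eq_zero_iff_of_nonneg fun i hi => neg_nonneg.2 (h1 i hi)] at this
          simpa using this i hi
        · exact (Finset.sum_eq_zero_iff_of_nonneg
            fun j hj => h2 j (Finset.mem_compl.1 hj)).1 h0.symm i (Finset.mem_compl.2 hi)
      simp [hx]
    · funext i
      by_cases hi : i ∈ B
      · rw [sum_smul_rootVector_apply_of_mem subset_rfl _ hi, Finset.sum_filter,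
          Finset.sum_product, Finset.sum_eq_single_of_mem i hi fun b _ hb => by simp [hb]]
        simp only [if_true]
        rw [← Finset.sum_div, ← Finset.mul_sum, ← hs]
        field_simp
      · rw [sum_smul_rootVector_apply_of_notMem subset_rfl _ hi, Finset.sum_filter,
          Finset.sum_product_right,
          Finset.sum_eq_single_of_mem i (Finset.mem_compl.2 hi) fun b _ hb => by simp [hb]]
        simp only [if_true]
        rw [← Finset.sum_div, ← Finset.sum_mul, Finset.sum_neg_distrib, hsB]
        field_simp

end Roots

/-! ### Cuts of independent families of roots. -/

/-- The set `K` is crossed by the member `e` of `S` from inside to outside, and by no other member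
of `S`. -/
structure IsCut {α : Type*} (S : Finset (α × α)) (e : α × α) (K : Finset α) : Prop where
  fst_mem : e.1 ∈ K
  snd_notMem : e.2 ∉ K
  mem_iff : ∀ f ∈ S, f ≠ e → (f.1 ∈ K ↔ f.2 ∈ K)

/-- A family of linearly independent roots gives, for each of its members, a set which is crossed
by this member and by no other one. -/
theorem exists_isCut_of_linearIndepOn {α : Type*} [Fintype α] [DecidableEq α]
    {S : Finset (α × α)} (hS : LinearIndepOn ℝ rootVector (S : Set (α × α)))
    {e : α × α} (he : e ∈ S) : ∃ K : Finset α, IsCut S e K := by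
  obtain ⟨φ, hφ, hker⟩ :=
    Submodule.exists_le_ker_of_notMem (linearIndepOn_iff_notMem_span.1 hS e he)
  simp only [rootVector, map_sub, sub_ne_zero] at hφ
  -- A level set of the potential `a ↦ φ (Pi.single a 1)`: `φ` kills every other root of `S`, so
  -- both ends of such a pair have the same potential.
  refine ⟨Finset.univ.filter fun a => φ (Pi.single a 1) = φ (Pi.single e.1 1), by simp,
    by simpa using hφ, fun f hf hfe => ?_⟩
  have h0 : φ (rootVector f) = 0 := hker (Submodule.subset_span ⟨f, ⟨hf, hfe⟩, rfl⟩)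
  rw [rootVector, map_sub, sub_eq_zero] at h0
  simp [h0]

/-- The coefficient of a root in a linear combination, read off from a cut. -/
theorem IsCut.coeff_eq {α : Type*} [DecidableEq α] {S : Finset (α × α)} {e : α × α} {K : Finset α}
    (hK : IsCut S e K) (he : e ∈ S) (c : α × α → ℝ) :
    c e = -∑ i ∈ K, (∑ f ∈ S, c f • rootVector f) i := by
  simp only [Finset.sum_apply, Pi.smul_apply]
  rw [Finset.sum_comm, Finset.sum_eq_single_of_mem e he]
  · rw [← Finset.smul_sum, sum_rootVector]
    simp [hK.fst_mem, hK.snd_notMem]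
  · intro f hf hfe
    rw [← Finset.smul_sum, sum_rootVector]
    simp [hK.mem_iff f hf hfe]

/-! ### Test points, their coefficients, and bases of roots. -/

section TestPoints

variable {α : Type*} [DecidableEq α] {B : Finset α} {S : Finset (α × α)}

/-- A generic integral translate: coordinate `1` off `B`, and `-(a i + 1 / |B|)` on `B`. -/
noncomputable def testPoint (B : Finset α) (a : α →₀ ℕ) (i : α) : ℝ :=
  if i ∈ B then -((a i : ℝ) + 1 / (B.card : ℝ)) else 1

theorem neg_sum_testPoint (B : Finset α) (a : α →₀ ℕ) (K : Finset α) :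
    -∑ i ∈ K, testPoint B a i =
      ((K ∩ B).card : ℝ) / B.card + ((∑ i ∈ K ∩ B, a i : ℕ) - ((K \ B).card : ℝ)) := by
  rw [← Finset.sum_inter_add_sum_sdiff K B,
    Finset.sum_congr rfl fun i hi => show testPoint B a i = -((a i : ℝ) + 1 / (B.card : ℝ)) from
      if_pos (Finset.mem_inter.1 hi).2,
    Finset.sum_congr rfl fun i hi => show testPoint B a i = 1 from
      if_neg (Finset.mem_sdiff.1 hi).2]
  rw [Finset.sum_neg_distrib, Finset.sum_add_distrib]
  simp
  ring

theorem card_inter_div_card_le_one (K B : Finset α) : ((K ∩ B).card : ℝ) / B.card ≤ 1 :=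
  div_le_one_of_le₀ (by exact_mod_cast Finset.card_le_card Finset.inter_subset_right)
    (Nat.cast_nonneg _)

theorem mem_span_image_finset {E ι : Type*} [AddCommGroup E] [Module ℝ E] {v : ι → E}
    {S : Finset ι} {x : E} :
    x ∈ Submodule.span ℝ (v '' S) ↔ ∃ c : ι → ℝ, ∑ e ∈ S, c e • v e = x := by
  classical
  constructor
  · intro h
    obtain ⟨c, rfl⟩ := (Submodule.mem_span_image_finset_iff_exists_fun _).1 h
    refine ⟨fun e => if he : e ∈ S then c ⟨e, he⟩ else 0, ?_⟩
    rw [← Finset.sum_coe_sort]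
    exact Finset.sum_congr rfl fun e _ => by simp only [e.2, dite_true]
  · rintro ⟨c, rfl⟩
    exact Submodule.sum_mem _ fun e he =>
      Submodule.smul_mem _ _ (Submodule.subset_span ⟨e, he, rfl⟩)

/-- The fractional part of the coefficients of a test point depends only on the cut. -/
theorem IsCut.coeff_testPoint {e : α × α} {K : Finset α} (hK : IsCut S e K) (he : e ∈ S)
    {a : α →₀ ℕ} {c : α × α → ℝ} (hc : ∑ f ∈ S, c f • rootVector f = testPoint B a) :
    c e = ((K ∩ B).card : ℝ) / B.card +
      (((∑ i ∈ K ∩ B, a i : ℕ) - (K \ B).card : ℤ) : ℝ) := by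
  rw [hK.coeff_eq he c, hc, neg_sum_testPoint]
  push_cast
  ring

variable [Fintype α]

/-- The weight vectors `a` whose test points lie on the hyperplane of sum zero. -/
def testWeights (B : Finset α) : Finset (α →₀ ℕ) := B.finsuppAntidiag (Bᶜ.card - 1)

theorem sum_of_mem_testWeights {a : α →₀ ℕ} (ha : a ∈ testWeights B) :
    ∑ i ∈ B, a i = Bᶜ.card - 1 :=
  (Finset.mem_finsuppAntidiag.1 ha).1

theorem sum_testPoint (hB : B.Nonempty) (hB' : Bᶜ.Nonempty) {a : α →₀ ℕ}
    (ha : a ∈ testWeights B) : ∑ i, testPoint B a i = 0 := by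
  have h := neg_sum_testPoint B a Finset.univ
  rw [Finset.univ_inter, sum_of_mem_testWeights ha, ← Finset.compl_eq_univ_sdiff,
    Nat.cast_sub hB'.card_pos, div_self (by exact_mod_cast hB.card_pos.ne')] at h
  push_cast at h
  linarith

theorem testPoint_mem_hull (hB : B.Nonempty) (hB' : Bᶜ.Nonempty) {a : α →₀ ℕ}
    (ha : a ∈ testWeights B) :
    testPoint B a ∈
      PointedCone.hull ℝ (rootVector '' ((B ×ˢ Bᶜ : Finset (α × α)) : Set (α × α))) := by
  refine mem_hull_rootVector_iff.2 ⟨fun i hi => ?_, fun j hj => ?_, sum_testPoint hB hB' ha⟩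
  · rw [testPoint, if_pos hi, neg_nonpos]
    positivity
  · rw [testPoint, if_neg hj]
    exact zero_le_one

theorem testPoint_injOn : Set.InjOn (testPoint B) (testWeights B : Set (α →₀ ℕ)) := by
  intro a ha b hb h
  ext i
  by_cases hi : i ∈ B
  · have := congrFun h i
    simpa [testPoint, hi] using this
  · have h1 := (Finset.mem_finsuppAntidiag.1 ha).2
    have h2 := (Finset.mem_finsuppAntidiag.1 hb).2
    rw [Finsupp.notMem_support_iff.1 fun h => hi (h1 h),
      Finsupp.notMem_support_iff.1 fun h => hi (h2 h)]

theorem testWeights_nonempty (hB : B.Nonempty) : (testWeights B).Nonempty := by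
  obtain ⟨i, hi⟩ := hB
  refine ⟨Finsupp.single i (Bᶜ.card - 1), Finset.mem_finsuppAntidiag.2 ⟨?_, ?_⟩⟩
  · rw [Finset.sum_eq_single_of_mem i hi fun j _ hj => Finsupp.single_eq_of_ne hj]
    exact Finsupp.single_eq_same
  · exact (Finsupp.support_single_subset).trans (by simpa using hi)

theorem card_testWeights (hB : B.Nonempty) (hB' : Bᶜ.Nonempty) :
    (testWeights B).card = (Fintype.card α - 2).choose (B.card - 1) := by
  have h1 := hB.card_pos
  have h2 := hB'.card_pos
  have h3 := Finset.card_add_card_compl B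
  rw [testWeights, Finset.card_finsuppAntidiag_nat_eq_choose]
  rw [show B.card + (Bᶜ.card - 1) - 1 = Fintype.card α - 2 by omega]
  exact Nat.choose_symm_of_eq_add (by omega)

theorem IsCut.ratio_pos {e : α × α} {K : Finset α} (hK : IsCut S e K) (hS : S ⊆ B ×ˢ Bᶜ)
    (he : e ∈ S) : 0 < ((K ∩ B).card : ℝ) / B.card := by
  have h := Finset.mem_product.1 (hS he)
  have h1 : 0 < (K ∩ B).card := Finset.card_pos.2 ⟨e.1, Finset.mem_inter.2 ⟨hK.fst_mem, h.1⟩⟩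
  have h2 : 0 < B.card := Finset.card_pos.2 ⟨e.1, h.1⟩
  positivity

/-- If `|K ∩ B| < |B|`, the coefficient is not an integer. Otherwise `B ⊆ K`, and the integer part
is `(|Bᶜ| - 1) - |K \ B| ≥ 0` because `e.2` lies outside `K` and `B`. -/
theorem IsCut.coeff_testPoint_ne_zero {e : α × α} {K : Finset α} (hK : IsCut S e K)
    (hS : S ⊆ B ×ˢ Bᶜ) (he : e ∈ S) {a : α →₀ ℕ} (ha : a ∈ testWeights B) {c : α × α → ℝ}
    (hc : ∑ f ∈ S, c f • rootVector f = testPoint B a) : c e ≠ 0 := by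
  have h := hK.coeff_testPoint he hc
  have h0 := hK.ratio_pos hS he
  rcases (card_inter_div_card_le_one K B).lt_or_eq with h1 | h1
  · intro hce
    rw [hce] at h
    set m : ℤ := (∑ i ∈ K ∩ B, a i : ℕ) - (K \ B).card
    have h2 : (-1 : ℝ) < m := by linarith
    have h3 : (m : ℝ) < 0 := by linarith
    have h2' : (-1 : ℤ) < m := by exact_mod_cast h2
    have h3' : m < 0 := by exact_mod_cast h3
    omega
  · have hcard : 0 < (B.card : ℝ) := by
      by_contra hcon
      have : (B.card : ℝ) = 0 := le_antisymm (not_lt.1 hcon) (Nat.cast_nonneg _)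
      rw [this] at h0
      simp at h0
    have h2 : (K ∩ B) = B := by
      refine Finset.eq_of_subset_of_card_le Finset.inter_subset_right ?_
      rw [div_eq_one_iff_eq hcard.ne'] at h1
      exact_mod_cast h1.ge
    rw [h1, h2, sum_of_mem_testWeights ha] at h
    have he2 := (Finset.mem_product.1 (hS he)).2
    have h3 : (K \ B).card < Bᶜ.card := by
      refine Finset.card_lt_card ⟨fun x hx => Finset.mem_compl.2 (Finset.mem_sdiff.1 hx).2, ?_⟩
      intro hsub
      exact hK.snd_notMem (Finset.mem_sdiff.1 (hsub he2)).1
    have h4 : (0 : ℝ) ≤ (((Bᶜ.card - 1 : ℕ) - (K \ B).card : ℤ) : ℝ) := by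
      exact_mod_cast (by omega : (0 : ℤ) ≤ ((Bᶜ.card - 1 : ℕ) - (K \ B).card : ℤ))
    rw [h]
    positivity

/-- A set of pairs whose roots form a basis of the space spanned by the roots from `B` to its
complement. -/
structure IsRootBasis (B : Finset α) (S : Finset (α × α)) : Prop where
  subset : S ⊆ B ×ˢ Bᶜ
  indep : LinearIndepOn ℝ rootVector (S : Set (α × α))
  span : ∀ e ∈ B ×ˢ Bᶜ, rootVector e ∈ Submodule.span ℝ (rootVector '' (S : Set (α × α)))

/-- The test points avoid the spans of non-maximal independent families of roots. -/
theorem isRootBasis_of_testPoint_mem_span (hS : S ⊆ B ×ˢ Bᶜ)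
    (hi : LinearIndepOn ℝ rootVector (S : Set (α × α))) {a : α →₀ ℕ} (ha : a ∈ testWeights B)
    (h : testPoint B a ∈ Submodule.span ℝ (rootVector '' (S : Set (α × α)))) :
    IsRootBasis B S := by
  obtain ⟨b, hb1, hb2, hb3, hb4⟩ :=
    exists_linearIndepOn_extension hi (Finset.coe_subset.2 hS)
  lift b to Finset (α × α) using b.toFinite
  rw [Finset.coe_subset] at hb1 hb2
  suffices hSb : S = b by
    subst hSb
    exact ⟨hS, hi, fun e he => hb3 ⟨e, he, rfl⟩⟩
  refine Finset.Subset.antisymm hb2 fun e he => ?_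
  by_contra heS
  obtain ⟨c, hc⟩ := mem_span_image_finset.1 h
  obtain ⟨K, hK⟩ := exists_isCut_of_linearIndepOn hb4 he
  -- Extending the coefficients by zero from `S` to the basis `b` gives coefficient `0` at `e ∉ S`,
  -- which no test point permits.
  refine hK.coeff_testPoint_ne_zero hb1 he ha (c := fun f => if f ∈ S then c f else 0) ?_
    (if_neg heS)
  rw [← hc, ← Finset.sum_subset hb2 fun f _ hf => by simp [hf]]
  exact Finset.sum_congr rfl fun f hf => by simp [hf]

theorem IsRootBasis.mem_span_of_sum_eq_zero (hB : B.Nonempty) (hB' : Bᶜ.Nonempty)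
    (hS : IsRootBasis B S) {x : α → ℝ} (hx : ∑ i, x i = 0) :
    x ∈ Submodule.span ℝ (rootVector '' (S : Set (α × α))) := by
  obtain ⟨i₀, hi₀⟩ := hB
  obtain ⟨j₀, hj₀⟩ := hB'
  have hsub : ∀ i, (Pi.single i 1 - Pi.single i₀ 1 : α → ℝ) ∈
      Submodule.span ℝ (rootVector '' (S : Set (α × α))) := by
    intro i
    have h0 := hS.span (i₀, j₀) (Finset.mem_product.2 ⟨hi₀, hj₀⟩)
    by_cases hi : i ∈ B
    · have h1 := hS.span (i, j₀) (Finset.mem_product.2 ⟨hi, hj₀⟩)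
      simpa [rootVector] using Submodule.sub_mem _ h0 h1
    · exact hS.span (i₀, i) (Finset.mem_product.2 ⟨hi₀, Finset.mem_compl.2 hi⟩)
  -- The base point `i₀` contributes nothing in total since the coordinates of `x` sum to zero.
  have : x = ∑ i, x i • (Pi.single i 1 - Pi.single i₀ 1 : α → ℝ) := by
    simp_rw [smul_sub]
    rw [Finset.sum_sub_distrib, ← Finset.sum_smul, hx, zero_smul, sub_zero]
    exact pi_eq_sum_univ' x
  rw [this]
  exact Submodule.sum_mem _ fun i _ => Submodule.smul_mem _ _ (hsub i)

/-- The span is the hyperplane of coordinate sum zero; this is the edge count of a spanning tree. -/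
theorem IsRootBasis.card_add_one (hB : B.Nonempty) (hB' : Bᶜ.Nonempty)
    (hS : IsRootBasis B S) : S.card + 1 = Fintype.card α := by
  let f : Module.Dual ℝ (α → ℝ) := ∑ i, LinearMap.proj i
  have hf : ∀ x, f x = ∑ i, x i := fun x => by simp [f]
  have hf0 : f ≠ 0 := by
    obtain ⟨i, -⟩ := hB
    intro h
    have := hf (Pi.single i 1)
    simp [h] at this
  have hspan : Submodule.span ℝ (rootVector '' (S : Set (α × α))) = LinearMap.ker f := by
    refine le_antisymm (Submodule.span_le.2 ?_) fun x hx =>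
      hS.mem_span_of_sum_eq_zero hB hB' ((hf x).symm.trans hx)
    rintro _ ⟨e, -, rfl⟩
    rw [SetLike.mem_coe, LinearMap.mem_ker, hf, sum_rootVector]
    simp
  have hrank := Module.Dual.finrank_ker_add_one_of_ne_zero hf0
  rw [← hspan, Module.finrank_fintype_fun_eq_card] at hrank
  rw [← hrank, Set.image_eq_range]
  congr 1
  have := finrank_span_eq_card (R := ℝ) (b := fun e : (S : Set (α × α)) => rootVector (e : α × α))
    hS.indep
  rw [this]
  simp

end TestPoints

/-! ### Exactly one test point in the cone of each basis of roots. -/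

section UniqueTestPoint

variable {α : Type*} [Fintype α] [DecidableEq α] {B : Finset α} {S : Finset (α × α)}

/-- The coefficients in the column of `e.2` are nonnegative with sum `1`, so `c e` lies in `(0, 1]`.
The ratio also lies there and differs from `c e` by an integer, so the two agree. -/
theorem IsCut.coeff_testPoint_eq_ratio {e : α × α} {K : Finset α} (hK : IsCut S e K)
    (hS : S ⊆ B ×ˢ Bᶜ) (he : e ∈ S) {a : α →₀ ℕ} (ha : a ∈ testWeights B) {c : α × α → ℝ}
    (hc0 : ∀ f ∈ S, 0 ≤ c f) (hc : ∑ f ∈ S, c f • rootVector f = testPoint B a) :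
    c e = ((K ∩ B).card : ℝ) / B.card := by
  have hne := hK.coeff_testPoint_ne_zero hS he ha hc
  have hpos : 0 < c e := lt_of_le_of_ne (hc0 e he) hne.symm
  have he2 := Finset.mem_compl.1 (Finset.mem_product.1 (hS he)).2
  have hle : c e ≤ 1 := by
    have h := congrFun hc e.2
    rw [sum_smul_rootVector_apply_of_notMem hS c he2, testPoint, if_neg he2] at h
    rw [← h]
    exact Finset.single_le_sum (f := c) (fun f hf => hc0 f (Finset.mem_filter.1 hf).1)
      (Finset.mem_filter.2 ⟨he, rfl⟩)
  have h := hK.coeff_testPoint he hc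
  have h0 := hK.ratio_pos hS he
  have h1 := card_inter_div_card_le_one K B
  set m : ℤ := (∑ i ∈ K ∩ B, a i : ℕ) - (K \ B).card
  have h2 : (-1 : ℝ) < m := by linarith
  have h3 : (m : ℝ) < 1 := by linarith
  have h2' : (-1 : ℤ) < m := by exact_mod_cast h2
  have h3' : m < 1 := by exact_mod_cast h3
  have h4 : m = 0 := by omega
  rw [h, h4, Int.cast_zero, add_zero]

theorem coeff_testPoint_pos (hS : S ⊆ B ×ˢ Bᶜ)
    (hi : LinearIndepOn ℝ rootVector (S : Set (α × α))) {a : α →₀ ℕ} (ha : a ∈ testWeights B)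
    {c : α × α → ℝ} (hc0 : ∀ f ∈ S, 0 ≤ c f)
    (hc : ∑ f ∈ S, c f • rootVector f = testPoint B a) {e : α × α} (he : e ∈ S) : 0 < c e := by
  obtain ⟨K, hK⟩ := exists_isCut_of_linearIndepOn hi he
  exact lt_of_le_of_ne (hc0 e he) (hK.coeff_testPoint_ne_zero hS he ha hc).symm

/-- The coefficients are dictated by the cuts of `S` alone, so two test points in the same cone
coincide. -/
theorem eq_of_testPoint_mem_hull (hS : S ⊆ B ×ˢ Bᶜ)
    (hi : LinearIndepOn ℝ rootVector (S : Set (α × α))) {a b : α →₀ ℕ}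
    (ha : a ∈ testWeights B) (hb : b ∈ testWeights B)
    (ha' : testPoint B a ∈ PointedCone.hull ℝ (rootVector '' (S : Set (α × α))))
    (hb' : testPoint B b ∈ PointedCone.hull ℝ (rootVector '' (S : Set (α × α)))) : a = b := by
  obtain ⟨c, hc0, hc⟩ := mem_hull_image_finset.1 ha'
  obtain ⟨d, hd0, hd⟩ := mem_hull_image_finset.1 hb'
  refine testPoint_injOn ha hb ?_
  rw [← hc, ← hd]
  refine Finset.sum_congr rfl fun e he => ?_
  obtain ⟨K, hK⟩ := exists_isCut_of_linearIndepOn hi he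
  rw [hK.coeff_testPoint_eq_ratio hS he ha hc0 hc, hK.coeff_testPoint_eq_ratio hS he hb hd0 hd]

theorem sum_mem_eq_sum_filter_fst (hS : S ⊆ B ×ˢ Bᶜ) {M : Type*} [AddCommMonoid M]
    (c : α × α → M) : ∑ i ∈ B, ∑ e ∈ S with e.1 = i, c e = ∑ e ∈ S, c e :=
  Finset.sum_fiberwise_of_maps_to (fun _ he => (Finset.mem_product.1 (hS he)).1) c

/-- Integer shifts of the coefficients keep row sums in `ℤ + 1/|B|` and column sums in `ℤ`. Counting
the edges of the tree then forces the shifted row and column sums to be those of a test point. -/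
theorem IsRootBasis.exists_testPoint_mem_hull (hB : B.Nonempty) (hB' : Bᶜ.Nonempty)
    (hS : IsRootBasis B S) : ∃ a ∈ testWeights B,
      testPoint B a ∈ PointedCone.hull ℝ (rootVector '' (S : Set (α × α))) := by
  classical
  have hr : 0 < (B.card : ℝ) := by exact_mod_cast hB.card_pos
  obtain ⟨a₀, ha₀⟩ := testWeights_nonempty hB
  obtain ⟨c, hc⟩ := mem_span_image_finset.1
    (hS.mem_span_of_sum_eq_zero hB hB' (sum_testPoint hB hB' ha₀))
  -- shift the coefficients of `testPoint B a₀` by integers into `(0, 1]`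
  have hex : ∀ e : α × α, ∃ (m : ℤ), e ∈ S → 0 < c e - m ∧ c e - m ≤ 1 := fun e => by
    refine ⟨⌈c e⌉ - 1, fun _ => ⟨?_, ?_⟩⟩
    · have := Int.ceil_lt_add_one (c e)
      push_cast
      linarith
    · have := Int.le_ceil (c e)
      push_cast
      linarith
  choose m hm using hex
  set x : α × α → ℝ := fun e => c e - m e with hx
  have hx0 : ∀ e ∈ S, 0 < x e := fun e he => (hm e he).1
  have hx1 : ∀ e ∈ S, x e ≤ 1 := fun e he => (hm e he).2
  -- every vertex is incident to a member of `S`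
  have hrow : ∀ i ∈ B, (S.filter fun e => e.1 = i).Nonempty := fun i hi => by
    by_contra h
    rw [Finset.not_nonempty_iff_eq_empty] at h
    have h1 := congrFun hc i
    rw [sum_smul_rootVector_apply_of_mem hS.subset c hi, h, testPoint, if_pos hi] at h1
    have : 0 < (a₀ i : ℝ) + 1 / (B.card : ℝ) := by positivity
    simp only [Finset.sum_empty, neg_zero] at h1
    linarith
  have hcol : ∀ j ∉ B, (S.filter fun e => e.2 = j).Nonempty := fun j hj => by
    by_contra h
    rw [Finset.not_nonempty_iff_eq_empty] at h
    have h1 := congrFun hc j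
    rw [sum_smul_rootVector_apply_of_notMem hS.subset c hj, h, testPoint, if_neg hj] at h1
    simp at h1
  -- row sums are `N i + 1 / |B|`, column sums are integers
  set N : α → ℤ := fun i => a₀ i - ∑ e ∈ S with e.1 = i, m e with hN
  have hrowsum : ∀ i ∈ B, ∑ e ∈ S with e.1 = i, x e = N i + 1 / (B.card : ℝ) := fun i hi => by
    have h1 := congrFun hc i
    rw [sum_smul_rootVector_apply_of_mem hS.subset c hi, testPoint, if_pos hi, neg_inj] at h1
    simp only [hx, hN, Finset.sum_sub_distrib, h1]
    push_cast
    ring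
  set P : α → ℤ := fun j => 1 - ∑ e ∈ S with e.2 = j, m e with hP
  have hcolsum : ∀ j ∉ B, ∑ e ∈ S with e.2 = j, x e = P j := fun j hj => by
    have h1 := congrFun hc j
    rw [sum_smul_rootVector_apply_of_notMem hS.subset c hj, testPoint, if_neg hj] at h1
    simp only [hx, hP, Finset.sum_sub_distrib, h1]
    push_cast
    ring
  have hrinv : 1 / (B.card : ℝ) ≤ 1 := by
    rw [div_le_one hr]
    exact_mod_cast hB.card_pos
  have hrinv0 : 0 < 1 / (B.card : ℝ) := by positivity
  have hN0 : ∀ i ∈ B, 0 ≤ N i := fun i hi => by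
    have h1 : 0 < ∑ e ∈ S with e.1 = i, x e :=
      Finset.sum_pos (fun e he => hx0 e (Finset.mem_filter.1 he).1) (hrow i hi)
    rw [hrowsum i hi] at h1
    have h2 : (-1 : ℝ) < N i := by linarith
    have h3 : (-1 : ℤ) < N i := by exact_mod_cast h2
    omega
  have hP1 : ∀ j ∈ Bᶜ, 1 ≤ P j := fun j hj => by
    have hj' := Finset.mem_compl.1 hj
    have h1 : 0 < ∑ e ∈ S with e.2 = j, x e :=
      Finset.sum_pos (fun e he => hx0 e (Finset.mem_filter.1 he).1) (hcol j hj')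
    rw [hcolsum j hj'] at h1
    have h3 : 0 < P j := by exact_mod_cast h1
    omega
  -- The summand `1/|B|` makes `N i` strictly smaller than the degree of `i`; integrality gains the
  -- extra `1`.
  have hdeg : ∀ i ∈ B, N i + 1 ≤ ((S.filter fun e => e.1 = i).card : ℤ) := fun i hi => by
    have h1 : ∑ e ∈ S with e.1 = i, x e ≤ (S.filter fun e => e.1 = i).card := by
      have := Finset.sum_le_card_nsmul (S.filter fun e => e.1 = i) x 1
        fun e he => hx1 e (Finset.mem_filter.1 he).1
      simpa using this
    rw [hrowsum i hi] at h1
    have h2 : (N i : ℝ) < (S.filter fun e => e.1 = i).card := by linarith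
    have h3 : N i < ((S.filter fun e => e.1 = i).card : ℤ) := by exact_mod_cast h2
    omega
  have hup : ∑ i ∈ B, N i + B.card ≤ S.card := by
    have h1 := Finset.sum_le_sum hdeg
    have h2 := sum_mem_eq_sum_filter_fst hS.subset (fun _ => (1 : ℤ))
    simp only [Finset.sum_const, nsmul_eq_mul, mul_one] at h2
    rw [h2, Finset.sum_add_distrib] at h1
    simpa using h1
  have htot : ∑ i ∈ B, N i + 1 = ∑ j ∈ Bᶜ, P j := by
    have h1 := sum_mem_eq_sum_filter_fst hS.subset x
    have h2 : ∑ j ∈ Bᶜ, ∑ e ∈ S with e.2 = j, x e = ∑ e ∈ S, x e :=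
      Finset.sum_fiberwise_of_maps_to
        (fun e he => (Finset.mem_product.1 (hS.subset he)).2) x
    rw [Finset.sum_congr rfl hrowsum, Finset.sum_add_distrib, ← h2,
      Finset.sum_congr rfl fun j hj => hcolsum j (Finset.mem_compl.1 hj)] at h1
    simp only [Finset.sum_const, nsmul_eq_mul] at h1
    rw [mul_one_div_cancel hr.ne'] at h1
    exact_mod_cast h1
  have hlow : (Bᶜ.card : ℤ) ≤ ∑ j ∈ Bᶜ, P j := by
    simpa using Finset.card_nsmul_le_sum Bᶜ P 1 hP1
  have hcard := hS.card_add_one hB hB'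
  have hcompl := Finset.card_add_card_compl B
  -- Squeeze: `hup` and the edge count `n - 1` bound the sum of `N` above by `|Bᶜ| - 1`, while
  -- `htot` and `hlow` bound it below by the same number.
  have hPsum : ∑ j ∈ Bᶜ, P j = Bᶜ.card := by omega
  have hNsum : ∑ i ∈ B, N i = Bᶜ.card - 1 := by omega
  have hPeq : ∀ j ∈ Bᶜ, P j = 1 := by
    have h1 : ∑ j ∈ Bᶜ, (P j - 1) = 0 := by
      rw [Finset.sum_sub_distrib, hPsum]
      simp
    intro j hj
    have := (Finset.sum_eq_zero_iff_of_nonneg fun j hj => sub_nonneg.2 (hP1 j hj)).1 h1 j hj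
    omega
  refine ⟨Finsupp.onFinset B (fun i => if i ∈ B then (N i).toNat else 0) (by simp +contextual),
    Finset.mem_finsuppAntidiag.2 ⟨?_, Finsupp.support_onFinset_subset⟩, ?_⟩
  · have h1 : ((∑ i ∈ B, (N i).toNat : ℕ) : ℤ) = ∑ i ∈ B, N i := by
      push_cast
      exact Finset.sum_congr rfl fun i hi => Int.toNat_of_nonneg (hN0 i hi)
    have h2 : ∑ i ∈ B, (N i).toNat = Bᶜ.card - 1 := by
      have := hB'.card_pos
      omega
    rw [← h2]
    exact Finset.sum_congr rfl fun i hi => by simp [hi]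
  · refine mem_hull_image_finset.2 ⟨x, fun e he => (hx0 e he).le, ?_⟩
    funext i
    by_cases hi : i ∈ B
    · rw [sum_smul_rootVector_apply_of_mem hS.subset x hi, hrowsum i hi, testPoint, if_pos hi]
      have h1 : (((N i).toNat : ℤ) : ℝ) = N i := by rw [Int.toNat_of_nonneg (hN0 i hi)]
      simp only [Finsupp.onFinset_apply, if_pos hi]
      rw [← h1, Int.cast_natCast]
    · rw [sum_smul_rootVector_apply_of_notMem hS.subset x hi, hcolsum i hi,
        hPeq i (Finset.mem_compl.2 hi), testPoint, if_neg hi, Int.cast_one]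

end UniqueTestPoint

/-! ### Triangulations of the cone of roots. -/

section RootCone

variable {α : Type*} [Fintype α] [DecidableEq α] {B : Finset α}

/-- The cone generated by all roots from `B` to its complement. -/
noncomputable def rootCone (B : Finset α) : PointedCone ℝ (α → ℝ) :=
  PointedCone.hull ℝ (rootVector '' ((B ×ˢ Bᶜ : Finset (α × α)) : Set (α × α)))

/-- In a nonnegative combination of roots equal to `x`, the face property pulls every root with
positive coefficient onto the ray of `x`. -/
theorem exists_eq_smul_rootVector_of_isFaceOf {x : α → ℝ} (hx : x ≠ 0)
    (h : (PointedCone.hull ℝ {x}).IsFaceOf (rootCone B)) :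
    ∃ e ∈ B ×ˢ Bᶜ, ∃ t : ℝ, 0 < t ∧ rootVector e = t • x := by
  have hxC : x ∈ rootCone B := h.le (PointedCone.subset_hull rfl)
  obtain ⟨c, hc0, hc⟩ := mem_hull_image_finset.1 hxC
  obtain ⟨e, he, hce⟩ : ∃ e ∈ B ×ˢ Bᶜ, c e ≠ 0 := by
    by_contra! hcon
    exact hx (hc ▸ Finset.sum_eq_zero fun e he => by rw [hcon e he, zero_smul])
  have hmem : ∀ f ∈ B ×ˢ Bᶜ, rootVector f ∈ rootCone B := fun f hf =>
    PointedCone.subset_hull ⟨f, hf, rfl⟩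
  have hface : rootVector e ∈ PointedCone.hull ℝ {x} := by
    refine h.mem_of_smul_add_mem (hmem e he)
      (y := ∑ f ∈ (B ×ˢ Bᶜ).erase e, c f • rootVector f) ?_
      (lt_of_le_of_ne (hc0 e he) hce.symm) ?_
    · exact Submodule.sum_mem _ fun f hf => PointedCone.smul_mem _
        (hc0 f (Finset.mem_of_mem_erase hf)) (hmem f (Finset.mem_of_mem_erase hf))
    · rw [Finset.add_sum_erase _ (fun f => c f • rootVector f) he, hc]
      exact PointedCone.subset_hull rfl
  obtain ⟨t, ht⟩ := Submodule.mem_span_singleton.1 hface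
  refine ⟨e, he, t, lt_of_le_of_ne t.2 fun h0 => ?_, ht.symm⟩
  have h1 : rootVector e e.2 = 0 := by
    have h2 : (t : ℝ) • x = rootVector e := ht
    rw [← h2, ← h0, zero_smul, Pi.zero_apply]
  have hne : e.2 ≠ e.1 := fun h' => by
    have := Finset.mem_product.1 he
    exact Finset.mem_compl.1 this.2 (h' ▸ this.1)
  simp [rootVector, hne] at h1

theorem exists_finset_of_isFaceOf {s : Set (α → ℝ)} (hs : LinearIndepOn ℝ id s)
    (hface : ∀ x ∈ s, (PointedCone.hull ℝ {x}).IsFaceOf (rootCone B)) :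
    ∃ S ⊆ B ×ˢ Bᶜ, LinearIndepOn ℝ rootVector (S : Set (α × α)) ∧
      PointedCone.hull ℝ (rootVector '' (S : Set (α × α))) = PointedCone.hull ℝ s := by
  obtain rfl | ⟨x₀, hx₀⟩ := s.eq_empty_or_nonempty
  · exact ⟨∅, by simp, by simp, by simp⟩
  obtain ⟨e₀, -⟩ := exists_eq_smul_rootVector_of_isFaceOf (hs.ne_zero hx₀) (hface x₀ hx₀)
  have hex : ∀ x : α → ℝ, ∃ (e : α × α) (t : ℝ), x ∈ s →
      e ∈ B ×ˢ Bᶜ ∧ 0 < t ∧ rootVector e = t • x := fun x => by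
    by_cases hx : x ∈ s
    · obtain ⟨e, he, t, ht, h⟩ :=
        exists_eq_smul_rootVector_of_isFaceOf (hs.ne_zero hx) (hface x hx)
      exact ⟨e, t, fun _ => ⟨he, ht, h⟩⟩
    · exact ⟨e₀, 0, fun h => absurd h hx⟩
  choose e t h using hex
  have hli : LinearIndepOn ℝ rootVector (e '' s) := by
    refine LinearIndepOn.image_of_comp _ _ ?_
    have h1 := LinearIndependent.units_smul hs
      fun x : s => Units.mk0 (t x) (h x x.2).2.1.ne'
    have h2 : (fun x : s => rootVector (e x)) = fun x : s => t x • (x : α → ℝ) :=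
      funext fun x => (h x x.2).2.2
    rw [LinearIndepOn, Function.comp_def, h2]
    exact h1
  have hfin : (e '' s).Finite := Set.toFinite _
  refine ⟨hfin.toFinset, fun f hf => ?_, by simpa using hli, ?_⟩
  · obtain ⟨x, hx, rfl⟩ := hfin.mem_toFinset.1 hf
    exact (h x hx).1
  · rw [hfin.coe_toFinset]
    refine le_antisymm (Submodule.span_le.2 ?_) (Submodule.span_le.2 fun x hx => ?_)
    · rintro _ ⟨_, ⟨x, hx, rfl⟩, rfl⟩
      rw [(h x hx).2.2]
      exact PointedCone.smul_mem _ (h x hx).2.1.le (PointedCone.subset_hull hx)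
    · have h1 : x = (t x)⁻¹ • rootVector (e x) := by
        rw [(h x hx).2.2, inv_smul_smul₀ (h x hx).2.1.ne']
      rw [h1]
      exact PointedCone.smul_mem _ (inv_nonneg.2 (h x hx).2.1.le)
        (PointedCone.subset_hull ⟨e x, ⟨x, hx, rfl⟩, rfl⟩)

variable {T : Set (PointedCone ℝ (α → ℝ))}

theorem IsConeTriangulation.exists_finset (hT : IsConeTriangulation (rootCone B) T)
    {σ : PointedCone ℝ (α → ℝ)} (hσ : σ ∈ T) :
    ∃ S ⊆ B ×ˢ Bᶜ, LinearIndepOn ℝ rootVector (S : Set (α × α)) ∧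
      PointedCone.hull ℝ (rootVector '' (S : Set (α × α))) = σ := by
  obtain ⟨s, -, hs, rfl, hface⟩ := hT.simplicial σ hσ
  exact exists_finset_of_isFaceOf hs hface

/-- A face of a cone that contains a strictly positive combination of the generators is the whole
cone. -/
theorem le_of_isFaceOf_of_sum_mem {E ι : Type*} [AddCommGroup E] [Module ℝ E] {v : ι → E}
    {S : Finset ι} {F : PointedCone ℝ E} (hF : F.IsFaceOf (PointedCone.hull ℝ (v '' S)))
    {c : ι → ℝ} (hc : ∀ e ∈ S, 0 < c e) (h : ∑ e ∈ S, c e • v e ∈ F) :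
    PointedCone.hull ℝ (v '' S) ≤ F := by
  classical
  refine Submodule.span_le.2 ?_
  rintro _ ⟨e, he, rfl⟩
  have hmem : ∀ f ∈ S, v f ∈ PointedCone.hull ℝ (v '' S) := fun f hf =>
    PointedCone.subset_hull ⟨f, hf, rfl⟩
  refine hF.mem_of_smul_add_mem (hmem e he) (y := ∑ f ∈ S.erase e, c f • v f) ?_ (hc e he) ?_
  · exact Submodule.sum_mem _ fun f hf => PointedCone.smul_mem _
      (hc f (Finset.mem_of_mem_erase hf)).le (hmem f (Finset.mem_of_mem_erase hf))
  · rwa [Finset.add_sum_erase _ (fun f => c f • v f) he]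

/-- All coefficients of a test point in `σ` are positive, so it lies on no proper face of `σ`; but
`σ ⊓ τ` is a face of `σ` containing it. -/
theorem IsConeTriangulation.le_of_testPoint_mem (hT : IsConeTriangulation (rootCone B) T)
    {a : α →₀ ℕ} (ha : a ∈ testWeights B) {σ τ : PointedCone ℝ (α → ℝ)} (hσ : σ ∈ T) (hτ : τ ∈ T)
    (hσa : testPoint B a ∈ σ) (hτa : testPoint B a ∈ τ) : σ ≤ τ := by
  obtain ⟨S, hS, hi, rfl⟩ := hT.exists_finset hσ
  obtain ⟨c, hc0, hc⟩ := mem_hull_image_finset.1 hσa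
  refine (le_of_isFaceOf_of_sum_mem (hT.inter_isFaceOf _ hσ _ hτ).1
    (fun e he => coeff_testPoint_pos hS hi ha hc0 hc he) ?_).trans inf_le_right
  rw [hc]
  exact ⟨hσa, hτa⟩

/-- Each cut sum is minus a coefficient, so the cuts supply the facet inequalities; this yields
closedness of the cone. -/
theorem IsRootBasis.mem_hull_iff {S : Finset (α × α)} (hB : B.Nonempty) (hB' : Bᶜ.Nonempty)
    (hS : IsRootBasis B S) {K : α × α → Finset α} (hK : ∀ e ∈ S, IsCut S e (K e)) {x : α → ℝ} :
    x ∈ PointedCone.hull ℝ (rootVector '' (S : Set (α × α))) ↔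
      ∑ i, x i = 0 ∧ ∀ e ∈ S, ∑ i ∈ K e, x i ≤ 0 := by
  constructor
  · intro h
    have hx : x ∈ rootCone B :=
      Submodule.span_mono (Set.image_mono (Finset.coe_subset.2 hS.subset)) h
    refine ⟨(mem_hull_rootVector_iff.1 hx).2.2, fun e he => ?_⟩
    obtain ⟨c, hc0, rfl⟩ := mem_hull_image_finset.1 h
    have := (hK e he).coeff_eq he c
    have := hc0 e he
    linarith
  · rintro ⟨h0, h⟩
    obtain ⟨c, rfl⟩ := mem_span_image_finset.1 (hS.mem_span_of_sum_eq_zero hB hB' h0)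
    refine mem_hull_image_finset.2 ⟨c, fun e he => ?_, rfl⟩
    have := (hK e he).coeff_eq he c
    have := h e he
    linarith

theorem IsRootBasis.isClosed_hull {S : Finset (α × α)} (hB : B.Nonempty) (hB' : Bᶜ.Nonempty)
    (hS : IsRootBasis B S) :
    IsClosed (PointedCone.hull ℝ (rootVector '' (S : Set (α × α))) : Set (α → ℝ)) := by
  have hex : ∀ e : α × α, ∃ K, e ∈ S → IsCut S e K := fun e => by
    by_cases he : e ∈ S
    · exact (exists_isCut_of_linearIndepOn hS.indep he).imp fun _ h _ => h
    · exact ⟨∅, fun h => absurd h he⟩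
  choose K hK using hex
  have : (PointedCone.hull ℝ (rootVector '' (S : Set (α × α))) : Set (α → ℝ)) =
      {x | ∑ i, x i = 0} ∩ ⋂ e ∈ S, {x | ∑ i ∈ K e, x i ≤ 0} := by
    ext x
    rw [SetLike.mem_coe, hS.mem_hull_iff hB hB' hK]
    simp
  rw [this]
  refine (isClosed_eq (by fun_prop) continuous_const).inter ?_
  exact isClosed_biInter fun e _ => isClosed_le (by fun_prop) continuous_const

/-- Every maximal cone of a triangulation is full-dimensional. -/
theorem IsConeTriangulation.exists_isRootBasis_of_maximal (hB : B.Nonempty) (hB' : Bᶜ.Nonempty)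
    (hT : IsConeTriangulation (rootCone B) T) {σ : PointedCone ℝ (α → ℝ)}
    (hσ : Maximal (fun τ => τ ∈ T) σ) :
    ∃ S, IsRootBasis B S ∧ PointedCone.hull ℝ (rootVector '' (S : Set (α × α))) = σ := by
  obtain ⟨S₀, hS₀, -, hσS⟩ := hT.exists_finset hσ.prop
  obtain ⟨a, ha⟩ := testWeights_nonempty hB
  set y := testPoint B a with hy
  set x : α → ℝ := ∑ e ∈ S₀, (1 : ℝ) • rootVector e with hx
  have hxσ : x ∈ σ := hσS ▸ mem_hull_image_finset.2 ⟨_, fun _ _ => zero_le_one, rfl⟩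
  have hσC : ∀ τ ∈ T, τ ≤ rootCone B := fun τ hτ z hz =>
    hT.union_eq.subset (Set.mem_biUnion hτ hz)
  -- Approach a relative interior point `x` of `σ` from the direction of a test point `y`. Since `T`
  -- is finite, one cone `τ` contains `z k` for infinitely many `k`.
  let z : ℕ → α → ℝ := fun k => x + (1 / ((k : ℝ) + 1)) • y
  have hzC : ∀ k, ∃ τ ∈ T, z k ∈ τ := fun k => by
    have : z k ∈ rootCone B := Submodule.add_mem _ (hσC σ hσ.prop hxσ)
      (PointedCone.smul_mem _ (by positivity) (testPoint_mem_hull hB hB' ha))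
    have h := hT.union_eq.superset this
    simpa using h
  obtain ⟨τ, hτT, hτ⟩ := hT.finite.frequently_exists.1
    (Filter.Frequently.of_forall (f := Filter.atTop) hzC)
  have hlim : Filter.Tendsto z Filter.atTop (nhds x) := by
    have h := (tendsto_one_div_add_atTop_nhds_zero_nat (𝕜 := ℝ)).smul_const y
    simpa [z] using h.const_add x
  obtain ⟨S, hS, hi, hτS⟩ := hT.exists_finset hτT
  -- The difference of two such `z k` is a nonzero multiple of `y`, so the span of `τ` contains a
  -- test point.
  have hbasis : IsRootBasis B S := by
    refine isRootBasis_of_testPoint_mem_span hS hi ha ?_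
    have hmem : ∀ w ∈ τ, w ∈ Submodule.span ℝ (rootVector '' (S : Set (α × α))) :=
      fun w hw => PointedCone.hull_le_span _ _ (hτS ▸ hw)
    obtain ⟨k, hk⟩ := hτ.exists
    obtain ⟨l, hl, hkl⟩ := (hτ.and_eventually (Filter.eventually_gt_atTop k)).exists
    have hsub := Submodule.sub_mem _ (hmem _ hk) (hmem _ hl)
    have heq : z k - z l = (1 / ((k : ℝ) + 1) - 1 / ((l : ℝ) + 1)) • y := by
      simp only [z]
      module
    have hne : (1 / ((k : ℝ) + 1) - 1 / ((l : ℝ) + 1)) ≠ 0 := by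
      have hkl' : (k : ℝ) < l := by exact_mod_cast hkl
      exact (sub_pos.2 (one_div_lt_one_div_of_lt (by positivity) (by linarith))).ne'
    rw [heq] at hsub
    exact (Submodule.smul_mem_iff _ hne).1 hsub
  have hxτ : x ∈ τ := by
    have hcl := hbasis.isClosed_hull hB hB'
    rw [hτS] at hcl
    exact hcl.mem_of_frequently_of_tendsto hτ hlim
  have hle : σ ≤ τ := by
    have h1 := (hT.inter_isFaceOf _ hσ.prop _ hτT).1
    have h2 : x ∈ σ ⊓ τ := ⟨hxσ, hxτ⟩
    subst hσS
    exact (le_of_isFaceOf_of_sum_mem h1 (fun _ _ => zero_lt_one) h2).trans inf_le_right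
  exact ⟨S, hbasis, hτS.trans (le_antisymm (hσ.le_of_ge hτT hle) hle)⟩

/-- The number of maximal cones of a triangulation of the cone of roots. -/
theorem IsConeTriangulation.numMaximalCones_eq (hB : B.Nonempty) (hB' : Bᶜ.Nonempty)
    (hT : IsConeTriangulation (rootCone B) T) :
    numMaximalCones T = (Fintype.card α - 2).choose (B.card - 1) := by
  rw [← card_testWeights hB hB', ← Set.ncard_coe_finset, numMaximalCones]
  have hex : ∀ a ∈ (testWeights B : Set (α →₀ ℕ)), ∃ σ,
      σ ∈ T ∧ testPoint B a ∈ σ := fun a ha => by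
    have h := hT.union_eq.superset (testPoint_mem_hull hB hB' ha)
    simpa using h
  choose g hgT hga using hex
  -- The bijection sends a weight to the cone of `T` that holds its test point.
  refine (Set.ncard_congr g ?_ ?_ ?_).symm
  · intro a ha
    refine ⟨hgT a ha, fun τ hτ hle => ?_⟩
    exact hT.le_of_testPoint_mem ha hτ (hgT a ha) (hle (hga a ha)) (hga a ha)
  · intro a b ha hb h
    obtain ⟨S, hS, hi, hσS⟩ := hT.exists_finset (hgT a ha)
    refine eq_of_testPoint_mem_hull hS hi ha hb ?_ ?_
    · rw [hσS]
      exact hga a ha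
    · rw [hσS, h]
      exact hga b hb
  · intro σ hσ
    obtain ⟨S, hS, hσS⟩ := hT.exists_isRootBasis_of_maximal hB hB' hσ
    obtain ⟨a, ha, hmem⟩ := hS.exists_testPoint_mem_hull hB hB'
    rw [hσS] at hmem
    exact ⟨a, ha, le_antisymm (hT.le_of_testPoint_mem ha (hgT a ha) hσ.prop (hga a ha) hmem)
      (hT.le_of_testPoint_mem ha hσ.prop (hgT a ha) hmem (hga a ha))⟩

end RootCone

/-! ### Bases and tangent cones of the uniform matroid. -/

theorem uniformMatroid_indep_iff {r n : ℕ} {I : Set (Fin n)} :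
    (uniformMatroid r n).Indep I ↔ I.ncard ≤ r := Iff.rfl

theorem uniformMatroid_isBase_iff {r n : ℕ} (hr : r ≤ n) {I : Set (Fin n)} :
    (uniformMatroid r n).IsBase I ↔ I.ncard = r := by
  rw [Matroid.isBase_iff_maximal_indep]
  constructor
  · intro h
    refine (uniformMatroid_indep_iff.1 h.prop).antisymm ?_
    by_contra! hlt
    obtain ⟨e, -, he⟩ := Set.exists_mem_notMem_of_ncard_lt_ncard
      (t := Set.univ) (hlt.trans_le (by simpa [Set.ncard_univ] using hr)) I.toFinite
    have hle : (insert e I).ncard ≤ r := (Set.ncard_insert_le e I).trans hlt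
    exact he (h.le_of_ge (uniformMatroid_indep_iff.2 hle) (Set.subset_insert e I)
      (Set.mem_insert e I))
  · intro h
    refine ⟨uniformMatroid_indep_iff.2 h.le, fun J hJ hIJ => ?_⟩
    exact (Set.eq_of_subset_of_ncard_le hIJ ((uniformMatroid_indep_iff.1 hJ).trans h.ge)).ge

theorem indicator_coe_apply {α : Type*} [DecidableEq α] (B : Finset α) (i : α) :
    (B : Set α).indicator (1 : α → ℝ) i = if i ∈ B then 1 else 0 := by
  simp [Set.indicator_apply]

theorem tangentConeOf_basePolytope_uniformMatroid {r n : ℕ} (hr : r ≤ n) {B : Finset (Fin n)}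
    (hB : B.card = r) :
    tangentConeOf (basePolytope (uniformMatroid r n)) ((B : Set (Fin n)).indicator 1) =
      rootCone B := by
  refine le_antisymm (Submodule.span_le.2 ?_) (Submodule.span_le.2 ?_)
  · rintro _ ⟨p, hp, rfl⟩
    -- Only this inclusion in a slice of the cube is needed: its inequalities already give those of
    -- the cone of roots.
    have hsub : basePolytope (uniformMatroid r n) ⊆
        {p | (∀ i, 0 ≤ p i) ∧ (∀ i, p i ≤ 1) ∧ ∑ i, p i = r} := by
      refine convexHull_min ?_ ?_
      · rintro _ ⟨A, hA, rfl⟩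
        rw [uniformMatroid_isBase_iff hr] at hA
        lift A to Finset (Fin n) using A.toFinite
        rw [Set.ncard_coe_finset] at hA
        simp only [Set.mem_ofPred_eq, indicator_coe_apply]
        refine ⟨fun i => by split_ifs <;> simp, fun i => by split_ifs <;> simp, ?_⟩
        simp [hA]
      · intro p hp q hq a b ha hb hab
        refine ⟨fun i => ?_, fun i => ?_, ?_⟩
        · have := mul_nonneg ha (hp.1 i)
          have := mul_nonneg hb (hq.1 i)
          simp only [Pi.add_apply, Pi.smul_apply, smul_eq_mul]
          linarith
        · have := mul_le_mul_of_nonneg_left (hp.2.1 i) ha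
          have := mul_le_mul_of_nonneg_left (hq.2.1 i) hb
          simp only [Pi.add_apply, Pi.smul_apply, smul_eq_mul]
          linarith
        · simp only [Pi.add_apply, Pi.smul_apply, smul_eq_mul]
          rw [Finset.sum_add_distrib, ← Finset.mul_sum, ← Finset.mul_sum, hp.2.2, hq.2.2,
            ← add_mul, hab, one_mul]
    obtain ⟨h0, h1, h2⟩ := hsub hp
    change p - (B : Set (Fin n)).indicator 1 ∈ rootCone B
    refine mem_hull_rootVector_iff.2 ⟨fun i hi => ?_, fun j hj => ?_, ?_⟩
    · rw [Pi.sub_apply, indicator_coe_apply, if_pos hi]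
      linarith [h1 i]
    · rw [Pi.sub_apply, indicator_coe_apply, if_neg hj, sub_zero]
      exact h0 j
    · simp only [Pi.sub_apply, indicator_coe_apply]
      rw [Finset.sum_sub_distrib, h2]
      simp [hB]
  · rintro _ ⟨e, he, rfl⟩
    obtain ⟨h1, h2⟩ := Finset.mem_product.1 (Finset.mem_coe.1 he)
    rw [Finset.mem_compl] at h2
    -- A root is the difference between the incidence vectors of `B` and of the basis obtained from
    -- it by one exchange.
    refine PointedCone.subset_hull ⟨((insert e.2 (B.erase e.1) : Finset (Fin n)) :
      Set (Fin n)).indicator 1, subset_convexHull ℝ _ ⟨_, ?_, rfl⟩, ?_⟩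
    · rw [uniformMatroid_isBase_iff hr, Set.ncard_coe_finset,
        Finset.card_insert_of_notMem (fun h => h2 (Finset.mem_of_mem_erase h)),
        Finset.card_erase_add_one h1, hB]
    · funext i
      simp only [Pi.sub_apply, indicator_coe_apply, rootVector, Pi.single_apply,
        Finset.mem_insert, Finset.mem_erase]
      by_cases hi1 : i = e.1
      · subst hi1
        have : e.1 ≠ e.2 := fun h => h2 (h ▸ h1)
        simp [this, h1]
      · by_cases hi2 : i = e.2
        · subst hi2
          simp [hi1, h2]
        · simp [hi1, hi2]

theorem numMaximalCones_tangentConeOf_uniformMatroid {n r : ℕ} (hr : 1 ≤ r) (hrn : r < n)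
    {v : Fin n → ℝ} (hv : v ∈ Set.extremePoints ℝ (basePolytope (uniformMatroid r n)))
    {T : Set (PointedCone ℝ (Fin n → ℝ))}
    (hT : IsConeTriangulation (tangentConeOf (basePolytope (uniformMatroid r n)) v) T) :
    numMaximalCones T = (n - 2).choose (r - 1) := by
  obtain ⟨A, hA, rfl⟩ := extremePoints_convexHull_subset hv
  rw [uniformMatroid_isBase_iff hrn.le] at hA
  lift A to Finset (Fin n) using A.toFinite
  rw [Set.ncard_coe_finset] at hA
  rw [tangentConeOf_basePolytope_uniformMatroid hrn.le hA] at hT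
  have h := hT.numMaximalCones_eq (Finset.card_pos.1 (by omega)) (Finset.card_pos.1 (by
    rw [Finset.card_compl, Fintype.card_fin]
    omega))
  rwa [Fintype.card_fin, hA] at h

/-! ### Exponential growth and the final statement. -/

theorem two_pow_le_centralBinom (k : ℕ) : 2 ^ k ≤ k.centralBinom := by
  induction k with
  | zero => simp
  | succ k ih =>
    have h := Nat.succ_mul_centralBinom_succ k
    refine le_of_mul_le_mul_left (a := k + 1) ?_ k.succ_pos
    rw [h, pow_succ]
    nlinarith

/-- The first part is the exact count; the second part is the exponential growth of the number of
maximal cones for the uniform matroids of rank `m` on `n = 2 * m` elements. -/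
theorem theorem2 :
    (∀ n r : ℕ, 1 ≤ r → r < n →
      ∀ v ∈ Set.extremePoints ℝ (basePolytope (uniformMatroid r n)),
      ∀ T : Set (PointedCone ℝ (Fin n → ℝ)),
        IsConeTriangulation (tangentConeOf (basePolytope (uniformMatroid r n)) v) T →
          numMaximalCones T = (n - 2).choose (r - 1)) ∧
    (∃ A c : ℝ, 0 < A ∧ 1 < c ∧ ∀ m : ℕ, 1 ≤ m →
      ∀ v ∈ Set.extremePoints ℝ (basePolytope (uniformMatroid m (2 * m))),
      ∀ T : Set (PointedCone ℝ (Fin (2 * m) → ℝ)),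
        IsConeTriangulation (tangentConeOf (basePolytope (uniformMatroid m (2 * m))) v) T →
          A * c ^ (2 * m) ≤ (numMaximalCones T : ℝ)) := by
  refine ⟨fun n r hr hrn v hv T hT => numMaximalCones_tangentConeOf_uniformMatroid hr hrn hv hT,
    -- For `m = k + 1` the count is `k.centralBinom ≥ 2 ^ k = 1/2 * 2 ^ m`, so any `c > 1` with `c ^
    -- 2 ≤ 2` serves; `5/4` is a rational choice.
    1 / 2, 5 / 4, by norm_num, by norm_num, fun m hm v hv T hT => ?_⟩
  rw [numMaximalCones_tangentConeOf_uniformMatroid hm (by omega) hv hT]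
  obtain ⟨k, rfl⟩ := Nat.exists_eq_add_of_le' hm
  rw [show 2 * (k + 1) - 2 = 2 * k by omega, Nat.add_sub_cancel,
    ← Nat.centralBinom_eq_two_mul_choose]
  have h : ((2 : ℝ) ^ k) ≤ k.centralBinom := by exact_mod_cast two_pow_le_centralBinom k
  refine le_trans ?_ h
  rw [pow_mul]
  calc (1 / 2 : ℝ) * ((5 / 4) ^ 2) ^ (k + 1) ≤ 1 / 2 * 2 ^ (k + 1) := by gcongr; norm_num
    _ = 2 ^ k := by ring
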